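/- Work with pointed compactly generated spaces: products $X\times Y$ carry the compactly generated topology, $X\wedge Y=(X\times Y)/(X\vee Y)$, $\Sigma$ is the reduced suspension, $D^{(n)}$ is the $n$-fold smash power of $D$ (with $D^{(0)}=S^0$). The James construction $D_\infty$ is the free monoid on $D$ with the base point as unit, topologized as a quotient of $\coprod_n D^n$. For a pair $(X,A)$, the relative James construction $(X,A)_\infty$ (the words in $X_\infty$ whose letters after the first lie in $A$) is the push-out of $X\times A_\infty\leftarrow A\times A_\infty\to A_\infty$, where the second map is the product of $A_\infty$; and $\rho\colon (X,A)_\infty\to X/A$ sends a word to the class of its first letter and $A_\infty$ to the base point. Let $(X,A)=(\Sigma Y,\Sigma B)$ be a suspension pair, where $B$ is a closed subspace of the compactly generated space $Y$ containing the base point, and let $r\ge 1$. Put $D=A^{(r-1)}$, so that $A^{(r)}=A\wedge D\subset X\wedge D$. Let $u\colon D\to[0,\infty)$ be a continuous function that vanishes exactly at the base point (such a $u$ exists whenever there is such a function on $B$, e.g. if $B$ is well pointed). It defines James' map $D_\infty\to\Omega\Sigma D$, which sends $d_1\cdots d_m$ to the concatenation of the loops $s\mapsto[s/u(d_i),d_i]$,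 $0\le s\le u(d_i)$, reparametrized linearly to $[0,1]$; let $\lambda\colon\Sigma D_\infty\to\Sigma D$ be its adjoint and let $$\alpha\colon X\wedge D_\infty\cong Y\wedge\Sigma D_\infty\xrightarrow{\,1\wedge\lambda\,}Y\wedge\Sigma D\cong X\wedge D .$$ Then for every continuous map $H_{r-1}\colon A_\infty\to (A^{(r-1)})_\infty$ (not necessarily pointed) there is a pointed map $$h\colon (X,A)_\infty\longrightarrow (X\wedge A^{(r-1)},A^{(r)})_\infty$$ such that the composition $$X\times A_\infty\longrightarrow (X,A)_\infty\xrightarrow{\ h\ }(X\wedge A^{(r-1)},A^{(r)})_\infty\xrightarrow{\ \rho\ }(X\wedge A^{(r-1)})/A^{(r)}$$ is (pointed) homotopic to the composition $$X\times A_\infty\xrightarrow{1\times H_{r-1}}X\times (A^{(r-1)})_\infty\longrightarrow X\wedge (A^{(r-1)})_\infty\xrightarrow{\ \alpha\ }X\wedge A^{(r-1)}\longrightarrow (X\wedge A^{(r-1)})/A^{(r)} .$$ -/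

import Mathlib

open Set Topology unitInterval

universe u v

noncomputable section

/-! ### Compactly generated products and collapsed quotients -/

/-- The product of two spaces in the category of compactly generated spaces: the cartesian product
with the compactly generated refinement of the product topology. -/
def KProd (X : Type v) (Y : Type u) : Type (max v u) := X × Y

instance KProd.instTopologicalSpace (X : Type v) (Y : Type u) [TopologicalSpace X]
    [TopologicalSpace Y] : TopologicalSpace (KProd X Y) :=
  TopologicalSpace.compactlyGenerated.{max v u} (X × Y)

/-- The equivalence relation that identifies all points of `S` with each other. -/
def collapseSetoid {X : Type u} (S : Set X) : Setoid X where
  r x y := x = y ∨ (x ∈ S ∧ y ∈ S)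
  iseqv :=
    { refl := fun _ => Or.inl rfl
      symm := by
        rintro x y (h | h)
        · exact Or.inl h.symm
        · exact Or.inr ⟨h.2, h.1⟩
      trans := by
        rintro x y z (rfl | h) (rfl | h')
        · exact Or.inl rfl
        · exact Or.inr h'
        · exact Or.inr h
        · exact Or.inr ⟨h.1, h'.2⟩ }

/-- The quotient space `X / S`, with the quotient topology. -/
def Collapse {X : Type u} (S : Set X) : Type u := Quotient (collapseSetoid S)

namespace Collapse

instance {X : Type u} [TopologicalSpace X] (S : Set X) : TopologicalSpace (Collapse S) :=
  inferInstanceAs (TopologicalSpace (Quotient (collapseSetoid S)))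

/-- The quotient map `X → X / S`. -/
def mk {X : Type u} (S : Set X) (x : X) : Collapse S := Quotient.mk (collapseSetoid S) x

theorem mk_eq {X : Type u} {S : Set X} {x y : X} (hx : x ∈ S) (hy : y ∈ S) : mk S x = mk S y :=
  Quotient.sound (s := collapseSetoid S) (Or.inr ⟨hx, hy⟩)

/-- The map `X / S → Z` induced by a map that sends `S` to one point. -/
def lift {X : Type u} {S : Set X} {Z : Type v} (f : X → Z) (z : Z) (hf : ∀ x ∈ S, f x = z) :
    Collapse S → Z :=
  Quotient.lift (s := collapseSetoid S) f (by
    rintro x y (h | h)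
    · rw [h]
    · rw [hf x h.1, hf y h.2])

@[simp]
theorem lift_mk {X : Type u} {S : Set X} {Z : Type v} (f : X → Z) (z : Z)
    (hf : ∀ x ∈ S, f x = z) (x : X) : lift f z hf (mk S x) = f x := rfl

end Collapse

/-! ### Pointed spaces -/

/-- A topological space with a base point. -/
structure PtdSpace : Type (u + 1) where
  /-- the underlying set -/
  carrier : Type u
  /-- the topology -/
  [top : TopologicalSpace carrier]
  /-- the base point -/
  pt : carrier

namespace PtdSpace

instance : CoeSort PtdSpace.{u} (Type u) := ⟨PtdSpace.carrier⟩

instance (X : PtdSpace.{u}) : TopologicalSpace X := X.top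

/-- The product of pointed spaces. -/
def prod (X Y : PtdSpace.{u}) : PtdSpace.{u} where
  carrier := KProd X Y
  pt := (X.pt, Y.pt)

/-- The quotient `X / A` for `j : A → X` (the inclusion of a pointed subspace). -/
def quot {A X : PtdSpace.{u}} (j : A → X) : PtdSpace.{u} where
  carrier := Collapse (range j)
  pt := Collapse.mk _ X.pt

/-- The quotient map `X → X / A`. -/
def toQuot {A X : PtdSpace.{u}} (j : A → X) (x : X) : quot j := Collapse.mk (range j) x

/-- The wedge `X ∨ Y` as a subset of `X × Y`. -/
def wedge (X Y : PtdSpace.{u}) : Set (X.prod Y) := {p | p.1 = X.pt ∨ p.2 = Y.pt}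

/-- The smash product `X ∧ Y = X × Y / X ∨ Y`. -/
def smash (X Y : PtdSpace.{u}) : PtdSpace.{u} where
  carrier := Collapse (wedge X Y)
  pt := Collapse.mk _ (X.pt, Y.pt)

/-- The quotient map `X × Y → X ∧ Y`, as a function of two variables. -/
def smashMk {X Y : PtdSpace.{u}} (x : X) (y : Y) : X.smash Y := Collapse.mk (wedge X Y) (x, y)

theorem smashMk_eq_pt {X Y : PtdSpace.{u}} {x : X} {y : Y} (h : x = X.pt ∨ y = Y.pt) :
    smashMk x y = (X.smash Y).pt :=
  Collapse.mk_eq h (Or.inl rfl)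

/-- The map `f ∧ g` induced by pointed maps `f` and `g`. -/
def smashMap {X X' Y Y' : PtdSpace.{u}} (f : X → X') (hf : f X.pt = X'.pt)
    (g : Y → Y') (hg : g Y.pt = Y'.pt) : X.smash Y → X'.smash Y' :=
  Collapse.lift (fun p => smashMk (f p.1) (g p.2)) (X'.smash Y').pt (by
    rintro ⟨x, y⟩ (h | h)
    · exact smashMk_eq_pt (Or.inl (by rw [← hf]; exact congrArg f h))
    · exact smashMk_eq_pt (Or.inr (by rw [← hg]; exact congrArg g h)))

theorem smashMap_pt {X X' Y Y' : PtdSpace.{u}} (f : X → X') (hf : f X.pt = X'.pt)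
    (g : Y → Y') (hg : g Y.pt = Y'.pt) :
    smashMap f hf g hg (X.smash Y).pt = (X'.smash Y').pt :=
  smashMk_eq_pt (Or.inl hf)

/-- The `0`-sphere. -/
def sphereZero : PtdSpace.{u} where
  carrier := ULift.{u} Bool
  pt := ⟨false⟩

/-- The iterated smash product `X^{(n)} = X ∧ ⋯ ∧ X` with `n` factors; `X^{(0)} = S⁰`. -/
def smashPow (X : PtdSpace.{u}) : ℕ → PtdSpace.{u}
  | 0 => sphereZero
  | n + 1 => X.smash (smashPow X n)

/-- The part of the cylinder `I × X` that is collapsed in the reduced suspension. -/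
def suspSet (X : PtdSpace.{u}) : Set (KProd I X) := {p | p.1 = 0 ∨ p.1 = 1 ∨ p.2 = X.pt}

/-- The reduced suspension of `X`. -/
def susp (X : PtdSpace.{u}) : PtdSpace.{u} where
  carrier := Collapse (suspSet X)
  pt := Collapse.mk _ (0, X.pt)

/-- The quotient map `I × X → ΣX`, as a function of two variables. -/
def suspMk {X : PtdSpace.{u}} (t : I) (x : X) : X.susp := Collapse.mk (suspSet X) (t, x)

theorem suspMk_eq_pt {X : PtdSpace.{u}} {t : I} {x : X} (h : t = 0 ∨ t = 1 ∨ x = X.pt) :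
    suspMk t x = X.susp.pt :=
  Collapse.mk_eq h (Or.inl rfl)

/-- The suspension of a pointed map. -/
def suspMap {X Y : PtdSpace.{u}} (f : X → Y) (hf : f X.pt = Y.pt) : X.susp → Y.susp :=
  Collapse.lift (fun p => suspMk p.1 (f p.2)) Y.susp.pt (by
    rintro ⟨t, x⟩ (h | h | h)
    · exact suspMk_eq_pt (Or.inl h)
    · exact suspMk_eq_pt (Or.inr (Or.inl h))
    · exact suspMk_eq_pt (Or.inr (Or.inr (by rw [← hf]; exact congrArg f h))))

theorem suspMap_pt {X Y : PtdSpace.{u}} (f : X → Y) (hf : f X.pt = Y.pt) :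
    suspMap f hf X.susp.pt = Y.susp.pt :=
  suspMk_eq_pt (Or.inl rfl)

/-- The canonical identification `ΣY ∧ W → Y ∧ ΣW`, `[t, y] ∧ w ↦ y ∧ [t, w]`. -/
def suspSmashToSmashSusp (Y W : PtdSpace.{u}) : Y.susp.smash W → Y.smash W.susp :=
  Collapse.lift
    (fun p => Collapse.lift (fun q : KProd I Y => smashMk (X := Y) (Y := W.susp) q.2
        (suspMk q.1 p.2)) (Y.smash W.susp).pt (by
      rintro ⟨t, y⟩ (h | h | h)
      · exact smashMk_eq_pt (Or.inr (suspMk_eq_pt (Or.inl h)))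
      · exact smashMk_eq_pt (Or.inr (suspMk_eq_pt (Or.inr (Or.inl h))))
      · exact smashMk_eq_pt (Or.inl h)) p.1)
    (Y.smash W.susp).pt (by
      rintro ⟨x, w⟩ (h | h)
      · change x = Y.susp.pt at h
        subst h
        exact smashMk_eq_pt (Or.inl rfl)
      · change w = W.pt at h
        subst h
        induction x using Quotient.inductionOn with
        | h q => exact smashMk_eq_pt (Or.inr (suspMk_eq_pt (Or.inr (Or.inr rfl)))))

/-- The inverse identification `Y ∧ ΣW → ΣY ∧ W`, `y ∧ [t, w] ↦ [t, y] ∧ w`. -/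
def smashSuspToSuspSmash (Y W : PtdSpace.{u}) : Y.smash W.susp → Y.susp.smash W :=
  Collapse.lift
    (fun p => Collapse.lift (fun q : KProd I W => smashMk (X := Y.susp) (Y := W)
        (suspMk q.1 p.1) q.2) (Y.susp.smash W).pt (by
      rintro ⟨t, w⟩ (h | h | h)
      · exact smashMk_eq_pt (Or.inl (suspMk_eq_pt (Or.inl h)))
      · exact smashMk_eq_pt (Or.inl (suspMk_eq_pt (Or.inr (Or.inl h))))
      · exact smashMk_eq_pt (Or.inr h)) p.2)
    (Y.susp.smash W).pt (by
      rintro ⟨y, x⟩ (h | h)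
      · change y = Y.pt at h
        subst h
        induction x using Quotient.inductionOn with
        | h q => exact smashMk_eq_pt (Or.inl (suspMk_eq_pt (Or.inr (Or.inr rfl))))
      · change x = W.susp.pt at h
        subst h
        exact smashMk_eq_pt (Or.inr rfl))

/-- Pointed homotopy of (pointed) maps. The continuity of `f` and `g` is part of it. -/
def Homotopic {X Y : PtdSpace.{u}} (f g : X → Y) : Prop :=
  ∃ F : C(I × X, Y), (∀ x, F (0, x) = f x) ∧ (∀ x, F (1, x) = g x) ∧ ∀ t, F (t, X.pt) = Y.pt

/-! ### The James construction -/

/-- The set of reduced words, i.e. of finite words whose letters differ from the base point. -/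
def Word (X : PtdSpace.{u}) : Type u := {l : List X // ∀ x ∈ l, x ≠ X.pt}

open Classical in
/-- Delete from a word all letters equal to the base point. -/
def reduce {X : PtdSpace.{u}} (l : List X) : Word X :=
  ⟨l.filter (fun x => x ≠ X.pt), fun x hx => by simpa using (List.mem_filter.1 hx).2⟩

/-- The final topology for the maps `Xⁿ → X_∞`, where `Xⁿ` is the compactly generated product. -/
instance (X : PtdSpace.{u}) : TopologicalSpace (Word X) :=
  ⨆ n : ℕ, TopologicalSpace.coinduced (fun x : Fin n → X => reduce (List.ofFn x))
    (TopologicalSpace.compactlyGenerated.{u} (Fin n → X))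

/-- The James construction (reduced product space) `X_∞`: the free monoid on `X` with the base
point as unit, a quotient of the disjoint union of all the `Xⁿ`. -/
def james (X : PtdSpace.{u}) : PtdSpace.{u} where
  carrier := Word X
  pt := reduce []

/-- The product of `x` and the word `w` in the monoid `X_∞`. -/
def jamesCons {X : PtdSpace.{u}} (x : X) (w : X.james) : X.james := reduce (x :: w.1)

/-! ### The relative James construction -/

/-- The identifications `(j a, w) ∼ a w` in the disjoint union of `X × A_∞` and `A_∞`. -/
inductive RelJamesRel {A X : PtdSpace.{u}} (j : A → X) :
    (X.prod A.james) ⊕ A.james → (X.prod A.james) ⊕ A.james → Prop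
  | glue (a : A) (w : A.james) : RelJamesRel j (Sum.inl (j a, w)) (Sum.inr (jamesCons a w))

/-- The relative James construction `(X, A)_∞` for `j : A → X` (the inclusion of a pointed
subspace): the push-out of `X × A_∞ ← A × A_∞ → A_∞`, where the second map is multiplication. -/
def relJames {A X : PtdSpace.{u}} (j : A → X) : PtdSpace.{u} where
  carrier := Quot (RelJamesRel j)
  pt := Quot.mk _ (Sum.inl (X.pt, A.james.pt))

/-- The structure map `X × A_∞ → (X, A)_∞`. -/
def toRelJames {A X : PtdSpace.{u}} (j : A → X) (p : X.prod A.james) : relJames j :=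
  Quot.mk _ (Sum.inl p)

/-- The map `ρ : (X, A)_∞ → X / A` onto the orbit space of the action of `A_∞`: a word is sent to
the class of its first letter, and `A_∞` is sent to the base point. -/
def rho {A X : PtdSpace.{u}} (j : A → X) (hj : j A.pt = X.pt) : relJames j → quot j :=
  Quot.lift (Sum.elim (fun p => toQuot j p.1) (fun _ => (quot j).pt)) (by
    rintro _ _ ⟨a, w⟩
    exact Collapse.mk_eq ⟨a, rfl⟩ ⟨A.pt, hj⟩)

/-! ### The collapse `X ∧ D_∞ → X ∧ D` for a suspension `X` -/

/-- A continuous function that vanishes exactly at the base point. -/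
structure Weight (D : PtdSpace.{u}) where
  /-- the function -/
  toFun : D → ℝ
  continuous_toFun : Continuous toFun
  nonneg : ∀ d, 0 ≤ toFun d
  eq_zero_iff : ∀ d, toFun d = 0 ↔ d = D.pt

/-- The underlying map from the compactly generated product to the product is continuous. -/
theorem _root_.KProd.continuous_id (X : Type v) (Y : Type u) [TopologicalSpace X]
    [TopologicalSpace Y] : Continuous (fun p : KProd X Y => ((p.1, p.2) : X × Y)) := by
  refine continuous_coinduced_dom.2 (continuous_sigma fun f => ?_)
  exact f.2.continuous

/-- A weight on `D` gives the weight `[t, d] ↦ t (1 - t) u(d)` on `ΣD`. -/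
def Weight.susp {D : PtdSpace.{u}} (w : Weight D) : Weight D.susp where
  toFun := Collapse.lift (fun p : KProd I D => (p.1 : ℝ) * (1 - p.1) * w.toFun p.2) 0 (by
    rintro ⟨t, d⟩ (h | h | h) <;> change _ = _ at h <;> dsimp only at h ⊢
    · simp [h]
    · simp [h]
    · simp [(w.eq_zero_iff d).2 h])
  continuous_toFun := by
    have hw := w.continuous_toFun
    have h : Continuous (fun p : I × D => (p.1 : ℝ) * (1 - p.1) * w.toFun p.2) := by fun_prop
    exact (h.comp (KProd.continuous_id I D)).quotient_lift _
  nonneg := by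
    intro x
    induction x using Quotient.inductionOn with
    | h q => exact mul_nonneg (mul_nonneg q.1.2.1 (by linarith [q.1.2.2])) (w.nonneg q.2)
  eq_zero_iff := by
    intro x
    induction x using Quotient.inductionOn with
    | h q =>
      obtain ⟨t, d⟩ := q
      change (t : ℝ) * (1 - t) * w.toFun d = 0 ↔ suspMk t d = D.susp.pt
      constructor
      · intro h
        rcases mul_eq_zero.1 h with h | h
        · rcases mul_eq_zero.1 h with h | h
          · exact suspMk_eq_pt (Or.inl (Subtype.ext h))
          · exact suspMk_eq_pt (Or.inr (Or.inl (Subtype.ext (sub_eq_zero.1 h).symm)))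
        · exact suspMk_eq_pt (Or.inr (Or.inr ((w.eq_zero_iff d).1 h)))
      · intro h
        rcases Quotient.exact (s := collapseSetoid (suspSet D)) h with h | ⟨h, -⟩
        · cases h
          simp
        · rcases h with h | h | h <;> change _ = _ at h <;> dsimp only at h
          · simp [h]
          · simp [h]
          · simp [(w.eq_zero_iff d).2 h]

/-- Weights on `D` and `E` give the weight `d ∧ e ↦ u(d) v(e)` on `D ∧ E`. -/
def Weight.smash {D E : PtdSpace.{u}} (w : Weight D) (z : Weight E) : Weight (D.smash E) where
  toFun := Collapse.lift (fun p => w.toFun p.1 * z.toFun p.2) 0 (by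
    rintro ⟨d, e⟩ (h | h) <;> change _ = _ at h <;> dsimp only at h ⊢
    · simp [(w.eq_zero_iff d).2 h]
    · simp [(z.eq_zero_iff e).2 h])
  continuous_toFun := by
    have hw := w.continuous_toFun
    have hz := z.continuous_toFun
    have h : Continuous (fun p : D × E => w.toFun p.1 * z.toFun p.2) := by fun_prop
    exact (h.comp (KProd.continuous_id D E)).quotient_lift _
  nonneg := by
    intro x
    induction x using Quotient.inductionOn with
    | h q => exact mul_nonneg (w.nonneg q.1) (z.nonneg q.2)
  eq_zero_iff := by
    intro x
    induction x using Quotient.inductionOn with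
    | h q =>
      obtain ⟨d, e⟩ := q
      change w.toFun d * z.toFun e = 0 ↔ smashMk d e = (D.smash E).pt
      rw [mul_eq_zero, w.eq_zero_iff, z.eq_zero_iff]
      refine ⟨smashMk_eq_pt, fun h => ?_⟩
      rcases Quotient.exact (s := collapseSetoid (wedge D E)) h with h | ⟨h, -⟩
      · cases h
        exact Or.inl rfl
      · exact h

/-- A weight on `D` gives a weight on every smash power of `D`. -/
def Weight.smashPow {D : PtdSpace.{u}} (w : Weight D) : (n : ℕ) → Weight (D.smashPow n)
  | 0 =>
    { toFun := fun b : ULift Bool => cond b.down 1 0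
      continuous_toFun := continuous_of_discreteTopology (α := ULift Bool)
      nonneg := by rintro ⟨_ | _⟩ <;> simp
      eq_zero_iff := by
        rintro ⟨_ | _⟩
        · simp [PtdSpace.smashPow, sphereZero]
        · simp [PtdSpace.smashPow, sphereZero] }
  | n + 1 => w.smash (w.smashPow n)

/-- The Moore loop in `ΣD` defined by a word: it is the concatenation of the loops
`s ↦ [s / u d, d]` of length `u d`, one for each letter `d`. -/
def mooreLoop {D : PtdSpace.{u}} (u : Weight D) : List D → ℝ → D.susp
  | [], _ => D.susp.pt
  | d :: l, s =>
      open Classical in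
      if s ≤ u.toFun d then suspMk (projIcc 0 1 zero_le_one (s / u.toFun d)) d
      else mooreLoop u l (s - u.toFun d)

theorem mooreLoop_zero {D : PtdSpace.{u}} (u : Weight D) (l : List D) :
    mooreLoop u l 0 = D.susp.pt := by
  cases l with
  | nil => rfl
  | cons d l =>
    rw [mooreLoop, if_pos (u.nonneg d)]
    exact suspMk_eq_pt (Or.inl (by simp))

theorem mooreLoop_sum {D : PtdSpace.{u}} (u : Weight D) (l : List D) :
    mooreLoop u l (l.map u.toFun).sum = D.susp.pt := by
  induction l with
  | nil => rfl
  | cons d l ih =>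
    rw [List.map_cons, List.sum_cons, mooreLoop]
    split_ifs with h
    · have h0 : 0 ≤ (l.map u.toFun).sum := List.sum_nonneg (by
        intro a ha
        obtain ⟨d', -, rfl⟩ := List.mem_map.1 ha
        exact u.nonneg d')
      have h1 : (l.map u.toFun).sum = 0 := by linarith
      rw [h1, add_zero]
      by_cases hd : u.toFun d = 0
      · exact suspMk_eq_pt (Or.inr (Or.inr ((u.eq_zero_iff d).1 hd)))
      · rw [div_self hd]
        exact suspMk_eq_pt (Or.inr (Or.inl (by simp)))
    · rw [add_sub_cancel_left]
      exact ih

/-- The map `ΣD_∞ → ΣD` adjoint to James' map `D_∞ → ΩΣD` which extends `D → ΩΣD`: at time `t` it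
evaluates the Moore loop of a word at the proportion `t` of its length. -/
def jamesEval {D : PtdSpace.{u}} (u : Weight D) : D.james.susp → D.susp :=
  Collapse.lift (fun p : KProd I D.james => mooreLoop u p.2.1 (p.1 * (p.2.1.map u.toFun).sum))
    D.susp.pt (by
      rintro ⟨t, w⟩ (h | h | h)
      · change t = 0 at h
        subst h
        simpa using mooreLoop_zero u w.1
      · change t = 1 at h
        subst h
        simpa using mooreLoop_sum u w.1
      · change w = D.james.pt at h
        subst h
        rfl)

theorem jamesEval_pt {D : PtdSpace.{u}} (u : Weight D) :
    jamesEval u D.james.susp.pt = D.susp.pt := rfl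

/-- The map `α : ΣY ∧ D_∞ = Y ∧ ΣD_∞ → Y ∧ ΣD = ΣY ∧ D`. -/
def alpha (Y : PtdSpace.{u}) {D : PtdSpace.{u}} (u : Weight D) :
    Y.susp.smash D.james → Y.susp.smash D :=
  smashSuspToSuspSmash Y D ∘ smashMap id rfl (jamesEval u) (jamesEval_pt u) ∘
    suspSmashToSmashSusp Y D.james

end PtdSpace

end

/-! The map `h` has an explicit formula. On words in `A`, put `hopf(a v) = α(a ∧ H(v)) · hopf(v)`,
so a word goes to the product of the letters `α(aₖ ∧ H(aₖ₊₁ ⋯ aₙ))`; on `X × A_∞`, send `(x, v)` to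
the word with first letter `α(x ∧ H(v))` followed by `hopf(v)`. The formula descends to the push-out
because `α` is natural in the desuspension (`alpha_suspMap`) and `hopf` satisfies the recursion
above on reduced words (`hopf_jamesCons`). The latter rests on `alpha_pt`: a letter equal to the
base point contributes the unit, whatever `H` does. Since `ρ` only sees the first letter, `ρ ∘ h`
agrees exactly with the required composition on `X × A_∞`, and a constant homotopy suffices.

The remaining work is continuity. Everything is tested along maps from compact Hausdorff spaces, and
`IsGenerating.kContinuous₂` allows these tests to be restricted to maps that lift to tuples of
letters or to cylinders. The delicate point is James' evaluation map where the length `u(d)` tends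
to `0` (`continuous_suspMk_div`). -/

noncomputable section

universe w

/-! ### Continuity on compact Hausdorff test spaces -/

section Test

variable {X Y T : Type*} [TopologicalSpace X] [TopologicalSpace Y] [TopologicalSpace T]

/-- A function of two variables is `k`-continuous if it is continuous along each pair of continuous
maps from a compact Hausdorff space, i.e. if it is continuous on the compactly generated product. -/
def KContinuous₂ (f : X → Y → T) : Prop :=
  ∀ (K : Type w) [TopologicalSpace K] [CompactSpace K] [T2Space K] (a : K → X) (b : K → Y),
    Continuous a → Continuous b → Continuous fun c => f (a c) (b c)

theorem KContinuous₂.flip {f : X → Y → T} (hf : KContinuous₂.{w} f) :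
    KContinuous₂.{w} fun y x => f x y :=
  fun K _ _ _ a b ha hb => hf K b a hb ha

/-- A class `P` of maps from compact Hausdorff spaces to `Z` is generating if its members cover `Z`
and the topology of `Z` is final with respect to them. -/
structure IsGenerating (Z : Type w) [TopologicalSpace Z]
    (P : ∀ (K : Type w) [TopologicalSpace K], (K → Z) → Prop) : Prop where
  continuous_of : ∀ (T : Type w) [TopologicalSpace T] (F : Z → T),
    (∀ (K : Type w) [TopologicalSpace K] [CompactSpace K] [T2Space K] (p : K → Z), P K p →
      Continuous fun c => F (p c)) → Continuous F
  exists_eq : ∀ z : Z, ∃ (K : Type w) (_ : TopologicalSpace K) (_ : CompactSpace K)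
    (_ : T2Space K) (p : K → Z) (c : K), P K p ∧ p c = z

/-- The exponential law: `k`-continuity may be tested on a generating class of maps to the second
factor. -/
theorem IsGenerating.kContinuous₂ {Z : Type w} [TopologicalSpace Z] {T : Type w}
    [TopologicalSpace T] {P : ∀ (K : Type w) [TopologicalSpace K], (K → Z) → Prop}
    (hP : IsGenerating Z P) {f : Y → Z → T}
    (hf : ∀ (K : Type w) [TopologicalSpace K] [CompactSpace K] [T2Space K]
      (L : Type w) [TopologicalSpace L] [CompactSpace L] [T2Space L]
      (a : K → Y) (p : L → Z), Continuous a → P L p →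
        Continuous fun c : L × K => f (a c.2) (p c.1)) :
    KContinuous₂.{w} f := by
  intro K _ _ _ a b ha hb
  have hz : ∀ z, Continuous fun c => f (a c) z := by
    intro z
    obtain ⟨L, _, _, _, p, l, hp, rfl⟩ := hP.exists_eq z
    exact (hf K L a p ha hp).comp (Continuous.prodMk_right l)
  -- Currying moves the question to a map out of `Z` alone, where the final topology applies.
  -- Uncurrying back is allowed because `K` is compact Hausdorff, hence locally compact.
  let F : Z → C(K, T) := fun z => ⟨fun c => f (a c) z, hz z⟩
  have hF : Continuous F := hP.continuous_of _ F fun L _ _ _ p hp =>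
    ContinuousMap.continuous_of_continuous_uncurry _ (hf K L a p ha hp)
  have := ContinuousMap.continuous_uncurry_of_continuous ⟨F, hF⟩
  exact this.comp (hb.prodMk continuous_id)

end Test

/-- The pair `(K, g)` is itself one of the summands whose evaluation map defines the refined
topology. -/
theorem continuous_compactlyGenerated_rng {X : Type*} {K : Type w} [TopologicalSpace X]
    [TopologicalSpace K] [CompactSpace K] [T2Space K] {g : K → X} (hg : Continuous g) :
    Continuous[_, TopologicalSpace.compactlyGenerated.{w} X] g := by
  let f : (Σ i : (S : CompHaus.{w}) × C(S, X), i.fst) → X := fun s => s.1.2 s.2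
  have h : Continuous[_, TopologicalSpace.compactlyGenerated.{w} X] f := continuous_coinduced_rng
  exact (@continuous_sigma_iff _ _ _ (_) (TopologicalSpace.compactlyGenerated.{w} X) _).1 h
    ⟨CompHaus.of K, ⟨g, hg⟩⟩

/-! ### Compactly generated products, smash products and suspensions -/

section KProd

variable {X : Type v} {Y : Type u} [TopologicalSpace X] [TopologicalSpace Y]

theorem KProd.continuous_of_kContinuous₂ {T : Type*} [TopologicalSpace T] {f : KProd X Y → T}
    (hf : KContinuous₂.{max v u} fun (x : X) (y : Y) => f (x, y)) : Continuous f :=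
  continuous_from_compactlyGenerated (X := X × Y) f fun S g =>
    hf S (fun c => (g c).1) (fun c => (g c).2) (by fun_prop) (by fun_prop)

theorem KProd.continuous_mk {K : Type max v u} [TopologicalSpace K] [CompactSpace K] [T2Space K]
    {a : K → X} {b : K → Y} (ha : Continuous a) (hb : Continuous b) :
    Continuous (Y := KProd X Y) fun c => (a c, b c) :=
  continuous_compactlyGenerated_rng (X := X × Y) (ha.prodMk hb)

end KProd

theorem Collapse.continuous_mk {X : Type u} [TopologicalSpace X] (S : Set X) :
    Continuous (Collapse.mk S) :=
  continuous_quotient_mk'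

theorem Collapse.continuous_dom {X : Type u} [TopologicalSpace X] {S : Set X} {T : Type*}
    [TopologicalSpace T] {f : Collapse S → T} (hf : Continuous fun x => f (Collapse.mk S x)) :
    Continuous f :=
  continuous_coinduced_dom.2 hf

namespace PtdSpace

variable {X Y B D : PtdSpace.{u}} {K : Type u} [TopologicalSpace K] [CompactSpace K]
  [T2Space K]

theorem continuous_smashMk {a : K → X} {b : K → Y} (ha : Continuous a) (hb : Continuous b) :
    Continuous fun c => smashMk (a c) (b c) :=
  (Collapse.continuous_mk (wedge X Y)).comp (KProd.continuous_mk ha hb)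

theorem continuous_suspMk {t : K → I} {x : K → X} (ht : Continuous t) (hx : Continuous x) :
    Continuous fun c => suspMk (t c) (x c) :=
  (Collapse.continuous_mk (suspSet X)).comp (KProd.continuous_mk ht hx)

/-- A map from a compact space to the suspension need not lift to the cylinder; since the suspension
is a quotient of the cylinder, the maps that do lift are enough. -/
theorem isGenerating_susp (X : PtdSpace.{u}) : IsGenerating X.susp fun K _ p =>
    ∃ (t : K → I) (x : K → X), Continuous t ∧ Continuous x ∧ p = fun c => suspMk (t c) (x c) where
  continuous_of T _ F hF := by
    refine Collapse.continuous_dom (KProd.continuous_of_kContinuous₂ ?_)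
    intro K _ _ _ t x ht hx
    exact hF K _ ⟨t, x, ht, hx, rfl⟩
  exists_eq z := by
    induction z using Quotient.inductionOn with
    | h q =>
      exact ⟨PUnit, inferInstance, inferInstance, inferInstance, fun _ => suspMk q.1 q.2,
        PUnit.unit, ⟨fun _ => q.1, fun _ => q.2, continuous_const, continuous_const, rfl⟩, rfl⟩

/-! ### The topology of the James construction -/

theorem reduce_val (v : X.james) : reduce v.1 = v :=
  Subtype.ext (List.filter_eq_self.2 fun x hx => by simpa using v.2 x hx)

theorem reduce_cons_of_eq {x : X} (hx : x = X.pt) (l : List X) : reduce (x :: l) = reduce l :=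
  Subtype.ext (by simp [reduce, hx])

theorem reduce_cons_val_of_ne {x : X} (hx : x ≠ X.pt) (l : List X) :
    (reduce (x :: l)).1 = x :: (reduce l).1 := by
  simp [reduce, hx]

theorem jamesCons_reduce (x : X) (l : List X) :
    jamesCons x (reduce l : X.james) = reduce (x :: l) := by
  by_cases hx : x = X.pt
  · rw [reduce_cons_of_eq hx]
    exact (reduce_cons_of_eq hx _).trans (reduce_val _)
  · refine Subtype.ext ?_
    rw [reduce_cons_val_of_ne hx]
    refine (reduce_cons_val_of_ne hx _).trans ?_
    exact congrArg _ (congrArg Subtype.val (reduce_val (X := X) (reduce l)))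

/-- A function on lists that ignores a leading base point does not change under reduction, if the
value on `x :: l` is determined by `x`, the reduction of `l` and the value on `l`. -/
theorem apply_reduce {T : Type*} {f : List X → T} (h0 : ∀ x l, x = X.pt → f (x :: l) = f l)
    (h1 : ∀ x l l', f l = f l' → reduce l = reduce l' → f (x :: l) = f (x :: l')) (l : List X) :
    f (reduce l).1 = f l := by
  induction l with
  | nil => rfl
  | cons x l ih =>
    by_cases hx : x = X.pt
    · rw [reduce_cons_of_eq hx, h0 x l hx, ih]
    · rw [reduce_cons_val_of_ne hx]
      exact h1 x _ _ ih (reduce_val (X := X) (reduce l))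

theorem continuous_reduce_ofFn {n : ℕ} {x : K → Fin n → X} (hx : Continuous x) :
    Continuous fun c => (reduce (List.ofFn (x c)) : X.james) := by
  have h : Continuous[TopologicalSpace.compactlyGenerated.{u} (Fin n → X), X.james.top]
      (fun x : Fin n → X => (reduce (List.ofFn x) : X.james)) :=
    continuous_iSup_rng (i := n) continuous_coinduced_rng
  exact @Continuous.comp _ _ _ _ (TopologicalSpace.compactlyGenerated.{u} (Fin n → X)) _ _ _ h
    (continuous_compactlyGenerated_rng hx)

theorem isGenerating_james (X : PtdSpace.{u}) : IsGenerating X.james fun K _ p =>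
    ∃ (n : ℕ) (x : K → Fin n → X), Continuous x ∧ p = fun c => reduce (List.ofFn (x c)) where
  continuous_of T _ F hF := by
    refine continuous_iSup_dom.2 fun n => continuous_coinduced_dom.2 ?_
    exact continuous_from_compactlyGenerated _ fun S g => hF S _ ⟨n, g, g.continuous, rfl⟩
  exists_eq z := by
    refine ⟨PUnit, inferInstance, inferInstance, inferInstance, fun _ => z, PUnit.unit,
      ⟨z.1.length, fun _ => z.1.get, continuous_const, ?_⟩, rfl⟩
    funext
    rw [List.ofFn_get, reduce_val]

theorem kContinuous₂_jamesCons : KContinuous₂.{u} (jamesCons : X → X.james → X.james) := by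
  refine (isGenerating_james X).kContinuous₂ ?_
  rintro K _ _ _ L _ _ _ a _ ha ⟨n, x, hx, rfl⟩
  have h : Continuous fun c : L × K => (Fin.cons (a c.2) (x c.1) : Fin (n + 1) → X) :=
    (ha.comp continuous_snd).finCons (hx.comp continuous_fst)
  refine (continuous_reduce_ofFn h).congr fun c => ?_
  rw [jamesCons_reduce, List.ofFn_cons]

/-! ### Continuity of `α` -/

/-- Where `u(d)` vanishes the quotient has no controlled limit, but there `[t, d]` is the base point
for every `t`, and compactness of `I` makes this uniform in `t`. -/
theorem continuous_suspMk_div (u : Weight D) {s : K → ℝ} {d : K → D} (hs : Continuous s)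
    (hd : Continuous d) :
    Continuous fun c => suspMk (projIcc 0 1 zero_le_one (s c / u.toFun (d c))) (d c) := by
  have hm : Continuous fun p : K × I => suspMk p.2 (d p.1) :=
    continuous_suspMk continuous_snd (hd.comp continuous_fst)
  rw [continuous_iff_continuousAt]
  intro c₀
  by_cases h0 : u.toFun (d c₀) = 0
  · have hpt : ∀ t, suspMk t (d c₀) = D.susp.pt := fun t =>
      suspMk_eq_pt (Or.inr (Or.inr ((u.eq_zero_iff _).1 h0)))
    intro V hV
    replace hV : V ∈ 𝓝 D.susp.pt := hpt (projIcc 0 1 _ _) ▸ hV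
    obtain ⟨V', hV', hVo, hmem⟩ := mem_nhds_iff.1 hV
    -- The whole segment `{c₀} × I` maps into the open set `V'`, hence so does `U × I` for a
    -- neighbourhood `U` of `c₀`.
    obtain ⟨U, U', hU, -, hcU, hU', hUU⟩ := generalized_tube_lemma (isCompact_singleton (x := c₀))
      (isCompact_univ (X := I)) (hVo.preimage hm) (by
        rintro ⟨c, t⟩ ⟨hc, -⟩
        rw [mem_singleton_iff] at hc
        subst hc
        rw [mem_preimage, hpt]
        exact hmem)
    refine Filter.mem_map.2 (Filter.mem_of_superset (hU.mem_nhds (hcU rfl)) fun c hc => ?_)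
    exact hV' (hUU (⟨hc, hU' (mem_univ _)⟩ : (c, _) ∈ U ×ˢ U'))
  · have hq : ContinuousAt (fun c => (c, projIcc (0 : ℝ) 1 zero_le_one (s c / u.toFun (d c)))) c₀ :=
      continuousAt_id.prodMk (continuous_projIcc.continuousAt.comp
        (hs.continuousAt.div (u.continuous_toFun.comp hd).continuousAt h0))
    exact hm.continuousAt.comp hq

theorem continuous_mooreLoop (u : Weight D) {n : ℕ} {s : K → ℝ} {x : K → Fin n → D}
    (hs : Continuous s) (hx : Continuous x) :
    Continuous fun c => mooreLoop u (List.ofFn (x c)) (s c) := by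
  induction n generalizing s with
  | zero => simpa [mooreLoop] using continuous_const
  | succ n ih =>
    have h0 : Continuous fun c => x c 0 := (continuous_apply 0).comp hx
    have hu : Continuous fun c => u.toFun (x c 0) := u.continuous_toFun.comp h0
    have ht : Continuous fun c => (fun i : Fin n => x c i.succ) := by fun_prop
    simp only [List.ofFn_succ, mooreLoop]
    -- The pieces agree at `s = u(d)`: the first loop has just closed and the next one is about to
    -- start.
    refine Continuous.if_le (continuous_suspMk_div u hs h0) (ih (hs.sub hu) ht) hs hu ?_
    intro c hc
    rw [hc, sub_self, mooreLoop_zero]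
    by_cases hd : u.toFun (x c 0) = 0
    · exact suspMk_eq_pt (Or.inr (Or.inr ((u.eq_zero_iff _).1 hd)))
    · rw [div_self hd]
      exact suspMk_eq_pt (Or.inr (Or.inl (by simp)))

theorem mooreLoop_of_nonpos (u : Weight D) (l : List D) {s : ℝ} (hs : s ≤ 0) :
    mooreLoop u l s = D.susp.pt := by
  cases l with
  | nil => rfl
  | cons d l =>
    rw [mooreLoop, if_pos (hs.trans (u.nonneg d))]
    exact suspMk_eq_pt (Or.inl (projIcc_of_le_left _
      (div_nonpos_of_nonpos_of_nonneg hs (u.nonneg d))))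

/-- A letter equal to the base point has weight `0`, so its loop has length `0` and can be dropped
without shifting the others. -/
theorem mooreLoop_reduce (u : Weight D) (l : List D) :
    mooreLoop u (reduce l).1 = mooreLoop u l := by
  refine apply_reduce (f := mooreLoop u) ?_ ?_ l
  · intro d l hd
    funext s
    rw [mooreLoop, (u.eq_zero_iff d).2 hd, sub_zero]
    -- The loop is defined for all real times; in the first case `s ≤ 0`, where every Moore loop is
    -- at the base point.
    split_ifs with hs
    · rw [mooreLoop_of_nonpos u l hs]
      exact suspMk_eq_pt (Or.inr (Or.inr hd))
    · rfl
  · intro d l l' h _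
    funext s
    rw [mooreLoop, mooreLoop, h]

theorem sum_map_reduce (u : Weight D) (l : List D) :
    ((reduce l).1.map u.toFun).sum = (l.map u.toFun).sum := by
  refine apply_reduce (f := fun l => (l.map u.toFun).sum) ?_ ?_ l
  · intro d l hd
    simp [(u.eq_zero_iff d).2 hd]
  · intro d l l' h _
    simpa using h

/-- Neither the loop nor its total length changes under reduction, so both can be computed from
unreduced tuples, on which they vary continuously. -/
theorem kContinuous₂_jamesEval (u : Weight D) :
    KContinuous₂.{u} fun (t : I) (v : D.james) => jamesEval u (suspMk t v) := by
  refine (isGenerating_james D).kContinuous₂ ?_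
  rintro K _ _ _ L _ _ _ t _ ht ⟨n, x, hx, rfl⟩
  have hu := u.continuous_toFun
  have hsum : Continuous fun c : L × K => (t c.2 : ℝ) * ∑ i, u.toFun (x c.1 i) := by fun_prop
  convert continuous_mooreLoop u hsum (hx.comp continuous_fst) using 2 with c
  change mooreLoop u (reduce (List.ofFn (x c.1))).1
    (t c.2 * ((reduce (List.ofFn (x c.1))).1.map u.toFun).sum) = _
  rw [mooreLoop_reduce, sum_map_reduce, List.map_ofFn, List.sum_ofFn]
  rfl

theorem kContinuous₂_smashSuspToSuspSmash (Y W : PtdSpace.{u}) :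
    KContinuous₂.{u} fun (y : Y) (z : W.susp) => smashSuspToSuspSmash Y W (smashMk y z) := by
  refine (isGenerating_susp W).kContinuous₂ ?_
  rintro K _ _ _ L _ _ _ y _ hy ⟨t, x, ht, hx, rfl⟩
  exact continuous_smashMk (continuous_suspMk (ht.comp continuous_fst) (hy.comp continuous_snd))
    (hx.comp continuous_fst)

/-- Once `x` is written as `[t, y]`, the value depends only on `y` and the James evaluation of `[t,
v]`; testing on the suspension factor makes such a lift available. -/
theorem kContinuous₂_alpha (Y : PtdSpace.{u}) (u : Weight D) :
    KContinuous₂.{u} fun (x : Y.susp) (v : D.james) => alpha Y u (smashMk x v) := by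
  refine KContinuous₂.flip ((isGenerating_susp Y).kContinuous₂ ?_)
  rintro K _ _ _ L _ _ _ v _ hv ⟨t, y, ht, hy, rfl⟩
  exact kContinuous₂_smashSuspToSuspSmash Y D _ _ _ (hy.comp continuous_fst)
    (kContinuous₂_jamesEval u _ _ _ (ht.comp continuous_fst) (hv.comp continuous_snd))

/-- Holding for every `v`, this is what makes pointedness of `H` unnecessary. -/
theorem alpha_pt (Y : PtdSpace.{u}) (u : Weight D) (v : D.james) :
    alpha Y u (smashMk Y.susp.pt v) = (Y.susp.smash D).pt := by
  have h : (smashMk Y.susp.pt v : Y.susp.smash D.james) = (Y.susp.smash D.james).pt :=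
    smashMk_eq_pt (Or.inl rfl)
  rw [h]
  exact smashMk_eq_pt (Or.inr rfl)

/-- Naturality in the desuspension: `α` changes the suspension coordinate and the `D_∞` factor, and
only carries the coordinate in `B` or `Y` along. -/
theorem alpha_suspMap (i : B → Y) (hi : i B.pt = Y.pt) (u : Weight D) (a : B.susp)
    (v : D.james) :
    alpha Y u (smashMk (suspMap i hi a) v) =
      smashMap (suspMap i hi) (suspMap_pt i hi) id rfl (alpha B u (smashMk a v)) := by
  induction a using Quotient.inductionOn with
  | h q =>
    change smashSuspToSuspSmash Y D (smashMk (i q.2) (jamesEval u (suspMk q.1 v))) =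
      smashMap _ _ id rfl (smashSuspToSuspSmash B D (smashMk q.2 (jamesEval u (suspMk q.1 v))))
    generalize jamesEval u (suspMk q.1 v) = z
    induction z using Quotient.inductionOn with
    | h p => rfl

/-! ### The Hopf invariant determined by `H` -/

/-- The word `∏ₖ α(aₖ ∧ H(aₖ₊₁ ⋯ aₙ))` in the letters of `ΣB ∧ D`. -/
def hopfList (u : Weight D) (H : B.susp.james → D.james) :
    List B.susp → (B.susp.smash D).james
  | [] => (B.susp.smash D).james.pt
  | a :: l => jamesCons (alpha B u (smashMk a (H (reduce l)))) (hopfList u H l)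

/-- The map `(ΣB)_∞ → (ΣB ∧ D)_∞` with `a v ↦ α(a ∧ H(v)) · hopf(v)`. -/
def hopf (u : Weight D) (H : B.susp.james → D.james) (v : B.susp.james) :
    (B.susp.smash D).james :=
  hopfList u H v.1

/-- A base point letter contributes the unit, and the other factors see the word after them only
through its reduction. -/
theorem hopf_reduce (u : Weight D) (H : B.susp.james → D.james) (l : List B.susp) :
    hopf u H (reduce l) = hopfList u H l := by
  refine apply_reduce (f := hopfList u H) ?_ ?_ l
  · rintro a l rfl
    rw [hopfList, alpha_pt, jamesCons, reduce_cons_of_eq rfl]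
    exact reduce_val _
  · intro a l l' h h'
    rw [hopfList, hopfList, h, h']

theorem hopf_jamesCons (u : Weight D) (H : B.susp.james → D.james) (a : B.susp)
    (v : B.susp.james) :
    hopf u H (jamesCons a v) = jamesCons (alpha B u (smashMk a (H v))) (hopf u H v) := by
  rw [jamesCons, hopf_reduce, hopfList, reduce_val, hopf]

theorem continuous_hopfList (u : Weight D) {H : B.susp.james → D.james} (hH : Continuous H)
    {n : ℕ} {x : K → Fin n → B.susp} (hx : Continuous x) :
    Continuous fun c => hopfList u H (List.ofFn (x c)) := by
  induction n with
  | zero => simpa [hopfList] using continuous_const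
  | succ n ih =>
    have h0 : Continuous fun c => x c 0 := (continuous_apply 0).comp hx
    have ht : Continuous fun c => (fun i : Fin n => x c i.succ) := by fun_prop
    simp only [List.ofFn_succ, hopfList]
    exact kContinuous₂_jamesCons K _ _
      (kContinuous₂_alpha B u K _ _ h0 (hH.comp (continuous_reduce_ofFn ht))) (ih ht)

theorem continuous_hopf (u : Weight D) {H : B.susp.james → D.james} (hH : Continuous H) :
    Continuous (hopf u H) := by
  refine (isGenerating_james B.susp).continuous_of _ _ ?_
  rintro K _ _ _ _ ⟨n, x, hx, rfl⟩
  simp only [hopf_reduce]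
  exact continuous_hopfList u hH hx

/-- The map `(ΣY, ΣB)_∞ → (ΣY ∧ D, ΣB ∧ D)_∞` with `(x, v) ↦ (α(x ∧ H(v)), hopf(v))`. -/
def relHopf (i : B → Y) (hi : i B.pt = Y.pt) (u : Weight D) (H : B.susp.james → D.james) :
    relJames (suspMap i hi) →
      relJames (smashMap (Y := D) (suspMap i hi) (suspMap_pt i hi) id rfl) :=
  Quot.lift
    (Sum.elim (fun p => toRelJames _ (alpha Y u (smashMk p.1 (H p.2)), hopf u H p.2))
      (fun v => Quot.mk _ (Sum.inr (hopf u H v))))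
    (by
      rintro _ _ ⟨a, v⟩
      change toRelJames _ (alpha Y u (smashMk (suspMap i hi a) (H v)), hopf u H v) =
        Quot.mk _ (Sum.inr (hopf u H (jamesCons a v)))
      -- By naturality the first letter comes from `α(a ∧ H(v))` in `ΣB ∧ D`, so the gluing relation
      -- of the target absorbs it into the word given by the recursion for `hopf`.
      rw [alpha_suspMap, hopf_jamesCons]
      exact Quot.sound (RelJamesRel.glue _ _))

theorem continuous_relHopf (i : B → Y) (hi : i B.pt = Y.pt) (u : Weight D)
    {H : B.susp.james → D.james} (hH : Continuous H) : Continuous (relHopf i hi u H) := by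
  refine continuous_quot_lift _ (Continuous.sumElim ?_ ?_)
  · refine KProd.continuous_of_kContinuous₂ ?_
    intro K _ _ _ x v hx hv
    exact continuous_quot_mk.comp (continuous_inl.comp (KProd.continuous_mk
      (kContinuous₂_alpha Y u K _ _ hx (hH.comp hv)) ((continuous_hopf u hH).comp hv)))
  · exact continuous_quot_mk.comp (continuous_inr.comp (continuous_hopf u hH))

end PtdSpace

end

/-- Here `(X, A) = (ΣY, ΣB)` for a pointed pair `i : B ⊆ Y`, and `r = n + 1`. -/
theorem theorem5p1 (Y B : PtdSpace.{u}) [CompactlyGeneratedSpace Y]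
    (i : B → Y) (hi : IsClosedEmbedding i) (hpt : i B.pt = Y.pt) (n : ℕ)
    (H : C((B.susp).james, (B.susp.smashPow n).james))
    (w : PtdSpace.Weight (B.susp.smashPow n)) :
    let X : PtdSpace.{u} := Y.susp
    let A : PtdSpace.{u} := B.susp
    let j : A → X := PtdSpace.suspMap i hpt
    let hj : j A.pt = X.pt := PtdSpace.suspMap_pt i hpt
    -- the inclusion of `A^{(r)}` into `X ∧ A^{(r-1)}`
    let k : A.smashPow (n + 1) → X.smash (A.smashPow n) := PtdSpace.smashMap j hj id rfl
    let hk : k (A.smashPow (n + 1)).pt = (X.smash (A.smashPow n)).pt :=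
      PtdSpace.smashMap_pt j hj id rfl
    ∃ h : C(PtdSpace.relJames j, PtdSpace.relJames k),
      h (PtdSpace.relJames j).pt = (PtdSpace.relJames k).pt ∧
      PtdSpace.Homotopic (X := X.prod A.james) (Y := PtdSpace.quot k)
        (fun p => PtdSpace.rho k hk (h (PtdSpace.toRelJames j p)))
        (fun p => PtdSpace.toQuot k
          (PtdSpace.alpha Y w (PtdSpace.smashMk (Y := (A.smashPow n).james) p.1 (H p.2)))) := by
  intro X A j hj k hk
  refine ⟨⟨PtdSpace.relHopf i hpt w H, PtdSpace.continuous_relHopf i hpt w H.continuous⟩, ?_, ?_⟩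
  · change PtdSpace.toRelJames k (PtdSpace.alpha Y w (PtdSpace.smashMk X.pt (H A.james.pt)), _) =
      PtdSpace.toRelJames k (_, _)
    rw [PtdSpace.alpha_pt]
    rfl
  · have hc : Continuous fun p : X.prod A.james => PtdSpace.toQuot k
        (PtdSpace.alpha Y w (PtdSpace.smashMk (Y := (A.smashPow n).james) p.1 (H p.2))) :=
      (Collapse.continuous_mk (range k)).comp (KProd.continuous_of_kContinuous₂
        fun K _ _ _ x v hx hv => PtdSpace.kContinuous₂_alpha Y w K x _ hx (H.continuous.comp hv))
    -- The homotopy is constant: `ρ` discards the `hopf` part of the word, so the two compositions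
    -- agree by definition. Only pointedness is left.
    refine ⟨⟨fun q => _, hc.comp continuous_snd⟩, fun _ => rfl, fun _ => rfl, fun _ => ?_⟩
    exact congrArg (PtdSpace.toQuot k) (PtdSpace.alpha_pt Y w (H A.james.pt))
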